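/- A trigraph $T$ is a finite set $V(T)$ with a map $\theta:\binom{V(T)}{2}\to\{-1,0,1\}$; distinct $u,v$ are strongly adjacent, semiadjacent (a switchable pair), strongly antiadjacent if $\theta(uv)=1,0,-1$ respectively; adjacent means $\theta(uv)\ge 0$, antiadjacent means $\theta(uv)\le 0$. The complement $\overline T$ has adjacency function $-\theta$, and $T|X$ is the restriction to $X$. The full realization of $T$ is the graph of adjacent pairs. A set $X$ is connected if the full realization of $T|X$ is connected (the empty set counts as connected), and anticonnected if it is connected in $\overline T$; components of $T|X$ are those of its full realization. A path of length $k-1$ is a sequence of distinct vertices $p_1,\dots,p_k$ with consecutive ones adjacent and all other pairs antiadjacent; a hole of length $k\ge 4$ is a cyclic sequence of $k$ distinct vertices with consecutive ones adjacent and all other pairs antiadjacent; antipaths and antiholes are paths and holes of $\overline T$. $T$ is Berge if it has no odd hole and no odd antihole. Let $\Sigma(T)$ be the graph of switchable pairs on $V(T)$. The class $\mathcal F$ consists of the Berge trigraphs $T$ such that every connected component of $\Sigma(T)$ has at most two edges, and every vertex $v$ of degree two in $\Sigma(T)$, with neighbors $x,y$ there, is either heavy ($v$ is strongly complete to $V(T)\setminus\{v,x,y\}$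 and $x,y$ are strongly adjacent) or light ($v$ is strongly anticomplete to $V(T)\setminus\{v,x,y\}$ and $x,y$ are strongly antiadjacent). A skew-partition is a partition $(A,B)$ of $V(T)$ with $A$ not connected and $B$ not anticonnected; it is balanced if there is no odd path of length greater than $1$ with ends in $B$ and interior in $A$, and no odd antipath of length greater than $1$ with ends in $A$ and interior in $B$. A 2-join of $T$ is a partition $(X_1,X_2)$ of $V(T)$ for which there are disjoint sets $A_1,B_1,C_1,A_2,B_2,C_2$ (a split) with $X_i=A_i\cup B_i\cup C_i$ such that: $A_1,A_2,B_1,B_2\neq\emptyset$; no switchable pair meets both $X_1$ and $X_2$; $A_1$ is strongly complete to $A_2$ and $B_1$ to $B_2$, and there are no other strong edges between $X_1$ and $X_2$; $|X_i|\ge 3$; and, if $|A_i|=|B_i|=1$, the full realization of $T|X_i$ is not a path of length two joining the members of $A_i$ and $B_i$. It is proper if, for $i=1,2$, every component of $T|X_i$ meets both $A_i$ and $B_i$. A (proper) complement 2-join of $T$, and its splits, are a (proper) 2-join of $\overline T$ and its splits. A proper 2-join of a Berge trigraph is odd (even) if the paths with one end in $A_i$, one end in $B_i$ and interior in $C_i$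 ($i=1,2$), whose lengths all have the same parity, are odd (even); the parity of a complement 2-join of $T$ is its parity as a 2-join of $\overline T$. A set $X\subseteq V(T)$ is a fragment of $T$ if $(X,V(T)\setminus X)$ is a proper 2-join or a proper complement 2-join of $T$. Let $X=X_1$ be a fragment of the Berge trigraph $T$, and $(A_1,B_1,C_1,A_2,B_2,C_2)$ a split of the corresponding (complement) 2-join. The block $T_X$ is obtained from $T|X$ by adding the following new (marker) vertices; every pair consisting of a marker and a vertex of $X$ which is not mentioned is strongly antiadjacent. - Odd 2-join: $a,b$, with $a$ strongly complete to $A_1$, $b$ strongly complete to $B_1$, and $ab$ a switchable pair. - Even 2-join: $a,b,c$, with $a$ strongly complete to $A_1$, $b$ strongly complete to $B_1$, $ac$ and $cb$ switchable pairs, and $ab$ a strong antiedge. - Odd complement 2-join: $a,b$, with $a$ strongly complete to $B_1\cup C_1$, $b$ strongly complete to $A_1\cup C_1$, and $ab$ a switchable pair. - Even complement 2-join: $a,b,c$, with $a$ strongly complete to $B_1\cup C_1$, $b$ strongly complete to $A_1\cup C_1$, $c$ strongly complete to $X$, $ac$ and $cb$ switchable pairs, and $ab$ a strong edge. **Theorem.**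 Let $T$ be a trigraph from $\mathcal F$ with no balanced skew-partition and let $X$ be a fragment of $T$. Then a block of decomposition $T_X$ exists, and every block of decomposition $T_X$ (for every choice of the decomposition and of its split) is a trigraph from $\mathcal F$. In particular $T_X$ is Berge. -/

import Mathlib

universe u v

/-- A trigraph with vertex set `V`: a symmetric adjacency function on pairs of distinct vertices
with values in `{-1, 0, 1}`. The diagonal carries no information and is normalised to `0`; all the
relations below speak about distinct vertices. Finiteness of `V` is assumed where it is used. -/
@[ext]
structure Trigraph (V : Type u) where
  θ : V → V → SignType
  symm : ∀ x y, θ x y = θ y x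
  diag : ∀ x, θ x x = 0

namespace Trigraph

variable {V : Type u}

/-- Strongly adjacent. -/
def StrongAdj (T : Trigraph V) (x y : V) : Prop := x ≠ y ∧ T.θ x y = 1

/-- Strongly antiadjacent. -/
def StrongAntiadj (T : Trigraph V) (x y : V) : Prop := x ≠ y ∧ T.θ x y = -1

/-- Semiadjacent, that is, `xy` is a switchable pair. -/
def Semiadj (T : Trigraph V) (x y : V) : Prop := x ≠ y ∧ T.θ x y = 0

def Adj (T : Trigraph V) (x y : V) : Prop := T.StrongAdj x y ∨ T.Semiadj x y

def Antiadj (T : Trigraph V) (x y : V) : Prop := T.StrongAntiadj x y ∨ T.Semiadj x y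

/-- The complement of a trigraph. -/
def compl (T : Trigraph V) : Trigraph V where
  θ x y := -T.θ x y
  symm x y := by rw [T.symm x y]
  diag x := by rw [T.diag x]; rfl

/-- The trigraph induced by `T` on `X`. -/
def induce (T : Trigraph V) (X : Set V) : Trigraph X where
  θ x y := T.θ x y
  symm x y := T.symm x y
  diag x := T.diag x

/-- The full realization: every switchable pair becomes an edge. -/
def fullRealization (T : Trigraph V) : SimpleGraph V where
  Adj x y := T.Adj x y
  symm := ⟨by
    rintro x y (⟨h, e⟩ | ⟨h, e⟩)
    · exact Or.inl ⟨h.symm, (T.symm y x).trans e⟩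
    · exact Or.inr ⟨h.symm, (T.symm y x).trans e⟩⟩
  loopless := ⟨by
    rintro x (⟨h, _⟩ | ⟨h, _⟩)
    · exact h rfl
    · exact h rfl⟩

/-- The graph `Σ(T)` of switchable pairs. -/
def switchGraph (T : Trigraph V) : SimpleGraph V where
  Adj x y := T.Semiadj x y
  symm := ⟨fun x y h => ⟨h.1.symm, (T.symm y x).trans h.2⟩⟩
  loopless := ⟨fun _ h => h.1 rfl⟩

/-- `X` is connected: the full realization of `T|X` is connected (the empty set is connected). -/
def IsConnected (T : Trigraph V) (X : Set V) : Prop :=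
  (T.induce X).fullRealization.Preconnected

/-- `X` is anticonnected: the graph of antiadjacent pairs of `T|X` is connected. -/
def IsAnticonnected (T : Trigraph V) (X : Set V) : Prop := T.compl.IsConnected X

/-- `p 0, …, p n` is a path of length `n`. -/
def IsPath (T : Trigraph V) {n : ℕ} (p : Fin (n + 1) → V) : Prop :=
  Function.Injective p ∧
  (∀ i j : Fin (n + 1), (i : ℕ) + 1 = j → T.Adj (p i) (p j)) ∧
  (∀ i j : Fin (n + 1), (i : ℕ) + 1 < j → T.Antiadj (p i) (p j))

/-- An antipath: a path of the complement. -/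
def IsAntipath (T : Trigraph V) {n : ℕ} (p : Fin (n + 1) → V) : Prop := T.compl.IsPath p

/-- `h 0, …, h (k - 1)` are the vertices of a hole of length `k`, in cyclic order. -/
def IsHole (T : Trigraph V) {k : ℕ} (h : Fin k → V) : Prop :=
  4 ≤ k ∧ Function.Injective h ∧
  (∀ i j : Fin k, (i : ℕ) + 1 = j ∨ (j : ℕ) + 1 = i + k → T.Adj (h i) (h j)) ∧
  (∀ i j : Fin k, (i : ℕ) + 1 < j → (j : ℕ) + 1 < i + k → T.Antiadj (h i) (h j))

/-- An antihole: a hole of the complement. -/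
def IsAntihole (T : Trigraph V) {k : ℕ} (h : Fin k → V) : Prop := T.compl.IsHole h

/-- A Berge trigraph: no odd hole and no odd antihole. -/
def IsBerge (T : Trigraph V) : Prop :=
  ∀ (k : ℕ) (h : Fin k → V), Odd k → ¬ T.IsHole h ∧ ¬ T.IsAntihole h

/-- `v`, a vertex whose neighbours in `Σ(T)` are `x` and `y`, is heavy. -/
def IsHeavy (T : Trigraph V) (v x y : V) : Prop :=
  (∀ w, w ≠ v → w ≠ x → w ≠ y → T.StrongAdj v w) ∧ T.StrongAdj x y

/-- `v`, a vertex whose neighbours in `Σ(T)` are `x` and `y`, is light. -/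
def IsLight (T : Trigraph V) (v x y : V) : Prop :=
  (∀ w, w ≠ v → w ≠ x → w ≠ y → T.StrongAntiadj v w) ∧ T.StrongAntiadj x y

/-- Membership in the class `𝓕`. -/
structure InF (T : Trigraph V) : Prop where
  berge : T.IsBerge
  /-- Every switchable component has at most two edges. -/
  edges_le_two : ∀ c : T.switchGraph.ConnectedComponent,
    {e ∈ T.switchGraph.edgeSet | ∀ w ∈ e, w ∈ c.supp}.encard ≤ 2
  /-- Every vertex of degree two in `Σ(T)` is heavy or light. -/
  heavy_or_light : ∀ v x y : V, x ≠ y → T.switchGraph.neighborSet v = {x, y} →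
    T.IsHeavy v x y ∨ T.IsLight v x y

/-- The pair `(A, B)` is balanced. -/
def IsBalanced (T : Trigraph V) (A B : Set V) : Prop :=
  (∀ (n : ℕ) (p : Fin (n + 1) → V), Odd n → 1 < n → T.IsPath p →
    p 0 ∈ B → p (Fin.last n) ∈ B → ¬ ∀ i, i ≠ 0 → i ≠ Fin.last n → p i ∈ A) ∧
  (∀ (n : ℕ) (p : Fin (n + 1) → V), Odd n → 1 < n → T.IsAntipath p →
    p 0 ∈ A → p (Fin.last n) ∈ A → ¬ ∀ i, i ≠ 0 → i ≠ Fin.last n → p i ∈ B)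

/-- `(A, B)` is a skew-partition. -/
def IsSkewPartition (T : Trigraph V) (A B : Set V) : Prop :=
  B = Aᶜ ∧ ¬ T.IsConnected A ∧ ¬ T.IsAnticonnected B

/-- `T` has a balanced skew-partition. -/
def HasBalancedSkewPartition (T : Trigraph V) : Prop :=
  ∃ A B : Set V, T.IsSkewPartition A B ∧ T.IsBalanced A B

/-- `A = {a}`, `B = {b}`, and the full realization of the trigraph induced on `A ∪ B ∪ C` is a path
of length two from `a` to `b` (so that `C` consists of its middle vertex `c`). -/
def IsTwoEdgePath (T : Trigraph V) (A B C : Set V) : Prop :=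
  ∃ a b c, A = {a} ∧ B = {b} ∧ C = {c} ∧
    T.fullRealization.Adj a c ∧ T.fullRealization.Adj c b ∧ ¬ T.fullRealization.Adj a b

/-- `(A₁, B₁, C₁, A₂, B₂, C₂)` is a split of the 2-join `(X₁, X₂)` of `T`. -/
structure IsSplit (T : Trigraph V) (X₁ X₂ A₁ B₁ C₁ A₂ B₂ C₂ : Set V) : Prop where
  partition : X₂ = X₁ᶜ
  eq₁ : X₁ = A₁ ∪ B₁ ∪ C₁
  eq₂ : X₂ = A₂ ∪ B₂ ∪ C₂
  disj₁ : Disjoint A₁ B₁ ∧ Disjoint A₁ C₁ ∧ Disjoint B₁ C₁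
  disj₂ : Disjoint A₂ B₂ ∧ Disjoint A₂ C₂ ∧ Disjoint B₂ C₂
  nonempty₁ : A₁.Nonempty ∧ B₁.Nonempty
  nonempty₂ : A₂.Nonempty ∧ B₂.Nonempty
  no_switch : ∀ x ∈ X₁, ∀ y ∈ X₂, ¬ T.Semiadj x y
  complete_A : ∀ x ∈ A₁, ∀ y ∈ A₂, T.StrongAdj x y
  complete_B : ∀ x ∈ B₁, ∀ y ∈ B₂, T.StrongAdj x y
  no_other : ∀ x ∈ X₁, ∀ y ∈ X₂, T.StrongAdj x y → (x ∈ A₁ ∧ y ∈ A₂) ∨ (x ∈ B₁ ∧ y ∈ B₂)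
  card₁ : 3 ≤ X₁.encard
  card₂ : 3 ≤ X₂.encard
  not_path₁ : ¬ T.IsTwoEdgePath A₁ B₁ C₁
  not_path₂ : ¬ T.IsTwoEdgePath A₂ B₂ C₂

/-- Every component of `T|X` meets both `A` and `B`. -/
def ComponentsMeet (T : Trigraph V) (X A B : Set V) : Prop :=
  ∀ c : (T.induce X).fullRealization.ConnectedComponent,
    (∃ x ∈ c.supp, (x : V) ∈ A) ∧ (∃ x ∈ c.supp, (x : V) ∈ B)

/-- `(A₁, B₁, C₁, A₂, B₂, C₂)` is a split of `(X₁, X₂)`, which is a proper 2-join of `T`. -/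
def IsProperSplit (T : Trigraph V) (X₁ X₂ A₁ B₁ C₁ A₂ B₂ C₂ : Set V) : Prop :=
  T.IsSplit X₁ X₂ A₁ B₁ C₁ A₂ B₂ C₂ ∧ T.ComponentsMeet X₁ A₁ B₁ ∧ T.ComponentsMeet X₂ A₂ B₂

/-- `(X₁, X₂)` is a proper 2-join of `T`. -/
def IsProperTwoJoin (T : Trigraph V) (X₁ X₂ : Set V) : Prop :=
  ∃ A₁ B₁ C₁ A₂ B₂ C₂ : Set V, T.IsProperSplit X₁ X₂ A₁ B₁ C₁ A₂ B₂ C₂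

/-- `X` is a fragment of `T`. -/
def IsFragment (T : Trigraph V) (X : Set V) : Prop :=
  T.IsProperTwoJoin X Xᶜ ∨ T.compl.IsProperTwoJoin X Xᶜ

/-- `p` is a path with one end in `A`, one end in `B` and interior in `C`. -/
def IsLinkingPath (T : Trigraph V) (A B C : Set V) {n : ℕ} (p : Fin (n + 1) → V) : Prop :=
  T.IsPath p ∧ p 0 ∈ A ∧ p (Fin.last n) ∈ B ∧ ∀ i, i ≠ 0 → i ≠ Fin.last n → p i ∈ C

/-- On one of the two sides of a 2-join with split `(A₁, B₁, C₁, A₂, B₂, C₂)` there is a path of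
length `n` with one end in `Aᵢ`, one end in `Bᵢ` and interior in `Cᵢ`. -/
def HasLinkingPath (T : Trigraph V) (A₁ B₁ C₁ A₂ B₂ C₂ : Set V) (n : ℕ) : Prop :=
  ∃ p : Fin (n + 1) → V, T.IsLinkingPath A₁ B₁ C₁ p ∨ T.IsLinkingPath A₂ B₂ C₂ p

/-- The 2-join with this split is odd. In a Berge trigraph the lengths of all the linking paths of
a proper 2-join have the same parity, so this parity can be read off from any one of them. -/
def IsOddSplit (T : Trigraph V) (A₁ B₁ C₁ A₂ B₂ C₂ : Set V) : Prop :=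
  ∃ n, Odd n ∧ T.HasLinkingPath A₁ B₁ C₁ A₂ B₂ C₂ n

/-- The 2-join with this split is even (see `IsOddSplit`). -/
def IsEvenSplit (T : Trigraph V) (A₁ B₁ C₁ A₂ B₂ C₂ : Set V) : Prop :=
  ∃ n, Even n ∧ T.HasLinkingPath A₁ B₁ C₁ A₂ B₂ C₂ n

/-- The trigraph obtained from `T|X` and the trigraph `M` on a set of new vertices by making
every new vertex `m` strongly complete to `N m ∩ X` and strongly anticomplete to `X \ N m`. -/
noncomputable def addMarkers (T : Trigraph V) (X : Set V) {W : Type v} (M : Trigraph W)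
    (N : W → Set V) : Trigraph (X ⊕ W) where
  θ := open Classical in fun
    | .inl x, .inl y => T.θ x y
    | .inl x, .inr m => if (x : V) ∈ N m then 1 else -1
    | .inr m, .inl x => if (x : V) ∈ N m then 1 else -1
    | .inr m, .inr m' => M.θ m m'
  symm := by
    rintro (x | m) (y | m')
    · exact T.symm x y
    · rfl
    · rfl
    · exact M.symm m m'
  diag := by
    rintro (x | m)
    · exact T.diag x
    · exact M.diag m

/-- The two marker vertices of an odd (complement) 2-join. -/
inductive OddMarker : Type
  | a | b

/-- The three marker vertices of an even (complement) 2-join. -/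
inductive EvenMarker : Type
  | a | b | c

/-- The markers `a` and `b` form a switchable pair. -/
def oddMarkers : Trigraph OddMarker where
  θ _ _ := 0
  symm _ _ := rfl
  diag _ := rfl

/-- The pairs `ac` and `cb` are switchable, and `ab` has the adjacency value `s`. -/
def evenMarkers (s : SignType) : Trigraph EvenMarker where
  θ
    | .a, .b => s
    | .b, .a => s
    | _, _ => 0
  symm := by rintro (_ | _ | _) (_ | _ | _) <;> rfl
  diag := by rintro (_ | _ | _) <;> rfl

/-- The block for a proper odd 2-join: `a` is strongly complete to `A`, `b` to `B`, and `ab` is a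
switchable pair. -/
noncomputable def oddBlock (T : Trigraph V) (X A B : Set V) : Trigraph (X ⊕ OddMarker) :=
  T.addMarkers X oddMarkers fun
    | .a => A
    | .b => B

/-- The block for a proper even 2-join: `a` is strongly complete to `A`, `b` to `B`, and `c` to
nothing; `ac` and `cb` are switchable pairs and `ab` is a strong antiedge. -/
noncomputable def evenBlock (T : Trigraph V) (X A B : Set V) : Trigraph (X ⊕ EvenMarker) :=
  T.addMarkers X (evenMarkers (-1)) fun
    | .a => A
    | .b => B
    | .c => ∅

/-- The block for a proper odd complement 2-join: `a` is strongly complete to `B ∪ C`, `b` to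
`A ∪ C`, and `ab` is a switchable pair. -/
noncomputable def oddCoBlock (T : Trigraph V) (X A B C : Set V) : Trigraph (X ⊕ OddMarker) :=
  T.addMarkers X oddMarkers fun
    | .a => B ∪ C
    | .b => A ∪ C

/-- The block for a proper even complement 2-join: `a` is strongly complete to `B ∪ C`, `b` to
`A ∪ C`, and `c` to `X`; `ac` and `cb` are switchable pairs and `ab` is a strong edge. -/
noncomputable def evenCoBlock (T : Trigraph V) (X A B C : Set V) : Trigraph (X ⊕ EvenMarker) :=
  T.addMarkers X (evenMarkers 1) fun
    | .a => B ∪ C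
    | .b => A ∪ C
    | .c => X

/-- `T.IsBlock X T'`: the trigraph `T'` is a block of decomposition `T_X` of `T` with respect to
the fragment `X`. The split of the (complement) 2-join is arbitrary. -/
inductive IsBlock (T : Trigraph V) (X : Set V) : {W : Type u} → Trigraph W → Prop
  | odd (A₁ B₁ C₁ A₂ B₂ C₂ : Set V) (hs : T.IsProperSplit X Xᶜ A₁ B₁ C₁ A₂ B₂ C₂)
      (hp : T.IsOddSplit A₁ B₁ C₁ A₂ B₂ C₂) : IsBlock T X (T.oddBlock X A₁ B₁)
  | even (A₁ B₁ C₁ A₂ B₂ C₂ : Set V) (hs : T.IsProperSplit X Xᶜ A₁ B₁ C₁ A₂ B₂ C₂)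
      (hp : T.IsEvenSplit A₁ B₁ C₁ A₂ B₂ C₂) : IsBlock T X (T.evenBlock X A₁ B₁)
  | oddCo (A₁ B₁ C₁ A₂ B₂ C₂ : Set V) (hs : T.compl.IsProperSplit X Xᶜ A₁ B₁ C₁ A₂ B₂ C₂)
      (hp : T.compl.IsOddSplit A₁ B₁ C₁ A₂ B₂ C₂) : IsBlock T X (T.oddCoBlock X A₁ B₁ C₁)
  | evenCo (A₁ B₁ C₁ A₂ B₂ C₂ : Set V) (hs : T.compl.IsProperSplit X Xᶜ A₁ B₁ C₁ A₂ B₂ C₂)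
      (hp : T.compl.IsEvenSplit A₁ B₁ C₁ A₂ B₂ C₂) : IsBlock T X (T.evenCoBlock X A₁ B₁ C₁)

end Trigraph

namespace Trigraph

variable {V : Type u} {W : Type v}

/-! ### Adjacency and complements -/

/-! A block of a complement 2-join of `T` is the complement of a block of a 2-join of `T.compl`
(`IsSplit.oddCoBlock_eq`, `IsSplit.evenCoBlock_eq`), and the class is closed under complementation,
so only 2-joins need work. A block exists because properness yields a linking path, whose length is
odd or even.

Bergeness rests on two facts. A marker `a` or `b` looks, from inside `X`, like any vertex of `A₂` or
`B₂`; hence an odd hole or antihole meeting at most one of the two, and no other marker, can be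
copied into `T` (`IsBerge.not_isHole_addMarkers`). And all linking paths have the same parity,
because one from each side close up to a hole of `T` (`IsSplit.linking_parity`). Deleting the
markers from an odd hole through both `a` and `b` leaves one or two linking paths, whose lengths
contradict this parity (`IsSplit.not_isHole_of_markers`). In an antihole of length at least seven
`a` and `b` would have a common neighbour, although `A₁` and `B₁` are disjoint. The marker `c` has
only `a` and `b` as neighbours, which makes its cases direct.

For the switchable pairs, none joins `X` to a marker, so a switchable component of the block lies in
`X` or among the markers. A degree-two vertex in `X` cannot be heavy in `T`, since no vertex of `X`
sees both `A₂` and `B₂`; if light, it lies outside `A₁ ∪ B₁` and so stays light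
(`IsSplit.addMarkers_heavy_or_light`). -/

theorem adj_iff (T : Trigraph V) {x y : V} : T.Adj x y ↔ x ≠ y ∧ T.θ x y ≠ -1 := by
  by_cases hxy : x = y
  · simp [Adj, StrongAdj, Semiadj, hxy]
  · simp only [Adj, StrongAdj, Semiadj, ne_eq, hxy, not_false_eq_true, true_and]
    generalize T.θ x y = s
    revert s
    decide

theorem antiadj_iff (T : Trigraph V) {x y : V} : T.Antiadj x y ↔ x ≠ y ∧ T.θ x y ≠ 1 := by
  by_cases hxy : x = y
  · simp [Antiadj, StrongAntiadj, Semiadj, hxy]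
  · simp only [Antiadj, StrongAntiadj, Semiadj, ne_eq, hxy, not_false_eq_true, true_and]
    generalize T.θ x y = s
    revert s
    decide

theorem Adj.symm {T : Trigraph V} {x y : V} (h : T.Adj x y) : T.Adj y x := by
  rw [adj_iff] at *
  exact ⟨h.1.symm, T.symm x y ▸ h.2⟩

theorem Antiadj.symm {T : Trigraph V} {x y : V} (h : T.Antiadj x y) : T.Antiadj y x := by
  rw [antiadj_iff] at *
  exact ⟨h.1.symm, T.symm x y ▸ h.2⟩

@[simp]
theorem compl_compl (T : Trigraph V) : T.compl.compl = T := by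
  ext x y : 3
  exact neg_neg _

theorem compl_strongAdj (T : Trigraph V) {x y : V} :
    T.compl.StrongAdj x y ↔ T.StrongAntiadj x y := by
  simp only [StrongAdj, StrongAntiadj, compl, neg_eq_iff_eq_neg]

theorem compl_strongAntiadj (T : Trigraph V) {x y : V} :
    T.compl.StrongAntiadj x y ↔ T.StrongAdj x y := by
  simp only [StrongAdj, StrongAntiadj, compl, neg_inj]

theorem compl_semiadj (T : Trigraph V) {x y : V} : T.compl.Semiadj x y ↔ T.Semiadj x y := by
  have : ∀ s : SignType, -s = 0 ↔ s = 0 := by decide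
  simp only [Semiadj, compl, this]

theorem compl_adj (T : Trigraph V) {x y : V} : T.compl.Adj x y ↔ T.Antiadj x y := by
  simp only [Adj, Antiadj, compl_strongAdj, compl_semiadj]

theorem compl_antiadj (T : Trigraph V) {x y : V} : T.compl.Antiadj x y ↔ T.Adj x y := by
  simp only [Adj, Antiadj, compl_strongAntiadj, compl_semiadj]

theorem compl_switchGraph (T : Trigraph V) : T.compl.switchGraph = T.switchGraph := by
  ext x y
  exact T.compl_semiadj

theorem IsBerge.compl {T : Trigraph V} (h : T.IsBerge) : T.compl.IsBerge := fun k g hk =>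
  ⟨(h k g hk).2, by simpa only [IsAntihole, compl_compl] using (h k g hk).1⟩

theorem InF.compl {T : Trigraph V} (h : T.InF) : T.compl.InF where
  berge := h.berge.compl
  edges_le_two := by
    rw [compl_switchGraph]
    exact h.edges_le_two
  heavy_or_light v x y hxy hv := by
    rw [compl_switchGraph] at hv
    simp only [IsHeavy, IsLight, compl_strongAdj, compl_strongAntiadj]
    exact (h.heavy_or_light v x y hxy hv).symm

/-! ### Holes and their segments -/

/-- The positions `i` and `j` are consecutive in a cyclic sequence of length `k`. -/
def CyclicConsec (k i j : ℕ) : Prop := i + 1 = j ∨ j + 1 = i ∨ j + 1 = i + k ∨ i + 1 = j + k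

theorem IsHole.adj {T : Trigraph V} {k : ℕ} {h : Fin k → V} (hh : T.IsHole h) {i j : Fin k}
    (hc : CyclicConsec k i j) : T.Adj (h i) (h j) := by
  rcases hc with hc | hc | hc | hc
  · exact hh.2.2.1 i j (Or.inl hc)
  · exact (hh.2.2.1 j i (Or.inl hc)).symm
  · exact hh.2.2.1 i j (Or.inr hc)
  · exact (hh.2.2.1 j i (Or.inr hc)).symm

theorem IsHole.antiadj {T : Trigraph V} {k : ℕ} {h : Fin k → V} (hh : T.IsHole h) {i j : Fin k}
    (hne : (i : ℕ) ≠ j) (hc : ¬ CyclicConsec k i j) : T.Antiadj (h i) (h j) := by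
  have hi := i.2
  have hj := j.2
  unfold CyclicConsec at hc
  rcases lt_or_gt_of_ne hne with hl | hl
  · exact hh.2.2.2 i j (by omega) (by omega)
  · exact (hh.2.2.2 j i (by omega) (by omega)).symm

theorem IsHole.of_consec {T : Trigraph V} {k : ℕ} {h : Fin k → V} (hk : 4 ≤ k)
    (hinj : Function.Injective h) (hadj : ∀ i j : Fin k, CyclicConsec k i j → T.Adj (h i) (h j))
    (hanti : ∀ i j : Fin k, (i : ℕ) ≠ j → ¬ CyclicConsec k i j → T.Antiadj (h i) (h j)) :
    T.IsHole h := by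
  refine ⟨hk, hinj, fun i j hij => hadj i j ?_, fun i j h1 h2 => hanti i j (by omega) ?_⟩ <;>
    unfold CyclicConsec <;> omega

theorem IsHole.rotate {T : Trigraph V} {k : ℕ} {h : Fin k → V} (hh : T.IsHole h) (i₀ : Fin k) :
    ∃ e : Equiv.Perm (Fin k), T.IsHole (h ∘ e) ∧ ∀ z : Fin k, (z : ℕ) = 0 → e z = i₀ := by
  have hk := hh.1
  have : NeZero k := ⟨by omega⟩
  -- Addition in `Fin k` wraps around at most once; this form makes the cyclic conditions linear.
  have hval : ∀ i : Fin k, ((i + i₀ : Fin k) : ℕ) = i + i₀ ∨ ((i + i₀ : Fin k) : ℕ) + k = i + i₀ := by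
    intro i
    rw [Fin.val_add]
    have hi := i.2
    have hi₀ := i₀.2
    rcases lt_or_ge ((i : ℕ) + i₀) k with hl | hl
    · exact Or.inl (Nat.mod_eq_of_lt hl)
    · right
      rw [Nat.mod_eq_sub_mod hl, Nat.mod_eq_of_lt (by omega)]
      omega
  refine ⟨Equiv.addRight i₀, IsHole.of_consec hk (hh.2.1.comp (Equiv.injective _)) ?_ ?_, ?_⟩
  · intro i j hij
    have h1 := hval i
    have h2 := hval j
    have hi := (i + i₀).2
    have hj := (j + i₀).2
    change T.Adj (h (i + i₀)) (h (j + i₀))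
    apply hh.adj
    generalize ((i + i₀ : Fin k) : ℕ) = p at *
    generalize ((j + i₀ : Fin k) : ℕ) = q at *
    unfold CyclicConsec at *
    omega
  · intro i j hne hij
    have h1 := hval i
    have h2 := hval j
    have hi := (i + i₀).2
    have hj := (j + i₀).2
    have hi' := i.2
    have hj' := j.2
    change T.Antiadj (h (i + i₀)) (h (j + i₀))
    apply hh.antiadj <;> generalize ((i + i₀ : Fin k) : ℕ) = p at * <;>
      generalize ((j + i₀ : Fin k) : ℕ) = q at * <;> unfold CyclicConsec at * <;> omega
  · intro z hz
    have : z = 0 := Fin.ext (by simpa using hz)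
    simp [this]

/-- Rotating a hole brings any of its vertices to position `0`. -/
theorem IsHole.exists_start {T : Trigraph V} {k : ℕ} {h : Fin k → V} (hh : T.IsHole h)
    (i₀ : Fin k) : ∃ h' : Fin k → V, T.IsHole h' ∧ Set.range h' = Set.range h ∧
      ∀ z : Fin k, (z : ℕ) = 0 → h' z = h i₀ := by
  obtain ⟨e, he, he0⟩ := hh.rotate i₀
  exact ⟨h ∘ e, he, e.surjective.range_comp h, fun z hz => congrArg h (he0 z hz)⟩

/-- The bound `n + 1 < k` leaves a vertex of the hole outside the segment, so the two ends are not
joined across the wrap-around. -/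
theorem IsHole.segment_isPath {T : Trigraph V} {k : ℕ} {h : Fin k → V} (hh : T.IsHole h)
    {s n : ℕ} (hn : s + n < k) (hnk : n + 1 < k) :
    T.IsPath (fun i : Fin (n + 1) => h ⟨s + i, by omega⟩) := by
  refine ⟨fun i j hij => ?_, fun i j hij => ?_, fun i j hij => ?_⟩
  · have := congrArg Fin.val (hh.2.1 hij)
    simp only at this
    exact Fin.ext (by omega)
  · exact hh.2.2.1 _ _ (Or.inl (by simp only; omega))
  · exact hh.2.2.2 _ _ (by simp only; omega) (by simp only; omega)

theorem IsPath.rev {T : Trigraph V} {n : ℕ} {p : Fin (n + 1) → V} (hp : T.IsPath p) :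
    T.IsPath (p ∘ Fin.rev) := by
  refine ⟨hp.1.comp Fin.rev_injective, fun i j hij => ?_, fun i j hij => ?_⟩
  · exact (hp.2.1 _ _ (by simp only [Fin.val_rev]; omega)).symm
  · exact (hp.2.2 _ _ (by simp only [Fin.val_rev]; omega)).symm

theorem IsHole.map {V' : Type v} {T : Trigraph V} {T' : Trigraph V'} {k : ℕ} {h : Fin k → V}
    (hh : T.IsHole h) {g : Fin k → V'} (hg : Function.Injective g)
    (hθ : ∀ i j, i ≠ j → T'.θ (g i) (g j) = T.θ (h i) (h j)) : T'.IsHole g := by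
  refine IsHole.of_consec hh.1 hg (fun i j hij => ?_) (fun i j hne hij => ?_)
  · have h1 := T.adj_iff.1 (hh.adj hij)
    have hne : i ≠ j := fun e => h1.1 (e ▸ rfl)
    exact T'.adj_iff.2 ⟨hg.ne hne, hθ i j hne ▸ h1.2⟩
  · have h1 := T.antiadj_iff.1 (hh.antiadj hne hij)
    have hne : i ≠ j := fun e => h1.1 (e ▸ rfl)
    exact T'.antiadj_iff.2 ⟨hg.ne hne, hθ i j hne ▸ h1.2⟩

/-- An antihole of length five is, after reordering, a hole of length five. -/
theorem IsAntihole.exists_isHole_five {T : Trigraph V} {h : Fin 5 → V} (hh : T.IsAntihole h) :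
    ∃ h' : Fin 5 → V, T.IsHole h' ∧ Set.range h' = Set.range h := by
  -- Steps of two around a pentagon: the complement of a 5-cycle is again a 5-cycle.
  have hσ : Function.Bijective (![0, 2, 4, 1, 3] : Fin 5 → Fin 5) := by decide
  refine ⟨h ∘ ![0, 2, 4, 1, 3], IsHole.of_consec (by omega) (hh.2.1.comp hσ.1) ?_ ?_,
    hσ.2.range_comp h⟩
  · intro i j hij
    rw [← compl_antiadj]
    apply IsHole.antiadj hh <;> revert i j <;> unfold CyclicConsec <;> decide
  · intro i j hne hij
    rw [← compl_adj]
    apply IsHole.adj hh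
    revert i j
    unfold CyclicConsec
    decide

/-! ### Trigraphs with marker vertices -/

section Markers

variable {T : Trigraph V} {X : Set V} {M : Trigraph W} {N : W → Set V}

theorem addMarkers_adj_inr_inl {w : W} {x : X} :
    (T.addMarkers X M N).Adj (.inr w) (.inl x) ↔ (x : V) ∈ N w := by
  rw [adj_iff]
  by_cases h : (x : V) ∈ N w <;> simp [addMarkers, h]

theorem addMarkers_antiadj_inr_inl {w : W} {x : X} :
    (T.addMarkers X M N).Antiadj (.inr w) (.inl x) ↔ (x : V) ∉ N w := by
  rw [antiadj_iff]
  by_cases h : (x : V) ∈ N w <;> simp [addMarkers, h]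

theorem addMarkers_semiadj_inl_inl {x y : X} :
    (T.addMarkers X M N).Semiadj (.inl x) (.inl y) ↔ T.Semiadj x y := by
  simp [Semiadj, addMarkers, Subtype.ext_iff]

theorem addMarkers_semiadj_inr_inr {w w' : W} :
    (T.addMarkers X M N).Semiadj (.inr w) (.inr w') ↔ M.Semiadj w w' := by
  simp [Semiadj, addMarkers]

theorem addMarkers_not_semiadj_inl_inr {x : X} {w : W} :
    ¬ (T.addMarkers X M N).Semiadj (.inl x) (.inr w) := by
  by_cases h : (x : V) ∈ N w <;> simp [Semiadj, addMarkers, h]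

theorem addMarkers_not_semiadj_inr_inl {x : X} {w : W} :
    ¬ (T.addMarkers X M N).Semiadj (.inr w) (.inl x) := by
  by_cases h : (x : V) ∈ N w <;> simp [Semiadj, addMarkers, h]

theorem IsPath.of_addMarkers {n : ℕ} {q : Fin (n + 1) → X ⊕ W}
    (hq : (T.addMarkers X M N).IsPath q) {x : Fin (n + 1) → X} (hx : ∀ i, q i = .inl (x i)) :
    T.IsPath (fun i => (x i : V)) := by
  obtain rfl : q = fun i => .inl (x i) := funext hx
  have hinj : Function.Injective (fun i => (x i : V)) := fun i j hij =>
    hq.1 (congrArg Sum.inl (Subtype.ext hij))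
  refine ⟨hinj, fun i j hij => ?_, fun i j hij => ?_⟩
  · have := (adj_iff _).1 (hq.2.1 i j hij)
    exact (adj_iff _).2 ⟨hinj.ne fun e => this.1 (e ▸ rfl), this.2⟩
  · have := (antiadj_iff _).1 (hq.2.2 i j hij)
    exact (antiadj_iff _).2 ⟨hinj.ne fun e => this.1 (e ▸ rfl), this.2⟩

/-- In a Berge trigraph, a hole or antihole which uses at most one marker is not odd, provided that
this marker behaves towards `X` like a vertex outside `X`. -/
theorem IsBerge.not_isHole_addMarkers (hT : T.IsBerge) {k : ℕ} (hk : Odd k) {h : Fin k → X ⊕ W}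
    (huniq : ∀ i j w w', h i = .inr w → h j = .inr w' → i = j)
    (hmimic : ∀ i w, h i = .inr w → ∃ v ∉ X, ∀ x ∈ X,
      (x ∈ N w → T.θ x v = 1) ∧ (x ∉ N w → T.θ x v = -1)) :
    ¬ (T.addMarkers X M N).IsHole h ∧ ¬ (T.addMarkers X M N).IsAntihole h := by
  -- The copy `g` of `h` in `T` keeps the vertices of `X` and replaces the marker by its stand-in
  -- outside `X`.
  have hex : ∀ i, ∃ v : V, (∀ x : X, h i = .inl x → v = x) ∧
      (∀ w, h i = .inr w → v ∉ X ∧ ∀ x ∈ X,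
      (x ∈ N w → T.θ x v = 1) ∧ (x ∉ N w → T.θ x v = -1)) := by
    intro i
    rcases hi : h i with x | w
    · exact ⟨x, by simp, by simp⟩
    · obtain ⟨v, hv, hx⟩ := hmimic i w hi
      refine ⟨v, by simp, ?_⟩
      rintro w' hw'
      cases hw'
      exact ⟨hv, hx⟩
  choose g hgl hgr using hex
  have hginj : Function.Injective h → Function.Injective g := by
    intro hinj i j hij
    rcases hi : h i with x | w <;> rcases hj : h j with y | w'
    · rw [hgl i x hi, hgl j y hj] at hij
      exact hinj (by rw [hi, hj, Subtype.ext hij])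
    · exact absurd (hij ▸ (hgl i x hi) ▸ x.2) (hgr j w' hj).1
    · exact absurd (hij.symm ▸ (hgl j y hj) ▸ y.2) (hgr i w hi).1
    · exact huniq i j w w' hi hj
  have hθ : ∀ i j, i ≠ j → T.θ (g i) (g j) = (T.addMarkers X M N).θ (h i) (h j) := by
    intro i j hne
    rcases hi : h i with x | w <;> rcases hj : h j with y | w'
    · rw [hgl i x hi, hgl j y hj]
      rfl
    · rw [hgl i x hi]
      have := (hgr j w' hj).2 x x.2
      by_cases hx : (x : V) ∈ N w' <;> simp [addMarkers, hx, this]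
    · rw [hgl j y hj, T.symm]
      have := (hgr i w hi).2 y y.2
      by_cases hx : (y : V) ∈ N w <;> simp [addMarkers, hx, this]
    · exact absurd (huniq i j w w' hi hj) hne
  refine ⟨fun hh => (hT k g hk).1 (hh.map (hginj hh.2.1) hθ), fun hh => (hT k g hk).2 ?_⟩
  exact IsHole.map hh (hginj hh.2.1) fun i j hne => congrArg Neg.neg (hθ i j hne)

/-- An equivalence holds because pairs between a marker and `X` are strong; a switchable pair could
occur both as an edge and as a non-edge of a hole. -/
theorem IsHole.marker_mem {k : ℕ} {h : Fin k → X ⊕ W} (hh : (T.addMarkers X M N).IsHole h)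
    {i j : Fin k} {w : W} {x : X} (hi : h i = .inr w) (hj : h j = .inl x) :
    (x : V) ∈ N w ↔ CyclicConsec k i j := by
  refine ⟨fun hx => ?_, fun hc => ?_⟩
  · by_contra hc
    have hne : (i : ℕ) ≠ j := fun e => by
      rw [Fin.ext e, hj] at hi
      cases hi
    have := hh.antiadj hne hc
    rw [hi, hj, addMarkers_antiadj_inr_inl] at this
    exact this hx
  · have := hh.adj hc
    rwa [hi, hj, addMarkers_adj_inr_inl] at this

/-- A segment of a hole which avoids the markers and runs from a neighbour of the marker `a` to a
neighbour of the marker `b`, or conversely, is a linking path. -/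
theorem IsHole.segment_parity {A B C : Set V} {r : ℕ}
    (hpar : ∀ (n : ℕ) (p : Fin (n + 1) → V), T.IsLinkingPath A B C p → n % 2 = r)
    (hX : X = A ∪ B ∪ C) {a b : W} (ha : N a = A) (hb : N b = B) {k : ℕ} {h : Fin k → X ⊕ W}
    (hh : (T.addMarkers X M N).IsHole h) {ia ib : Fin k} (hia : h ia = .inr a)
    (hib : h ib = .inr b) {s n : ℕ} (hn : s + n < k) (hnk : n + 1 < k)
    (hinl : ∀ j : Fin k, s ≤ j → j ≤ s + n → ∃ x, h j = .inl x)
    (hends : CyclicConsec k ia s ∧ CyclicConsec k ib (s + n) ∨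
      CyclicConsec k ib s ∧ CyclicConsec k ia (s + n))
    (hint : ∀ j, s < j → j < s + n → ¬ CyclicConsec k ia j ∧ ¬ CyclicConsec k ib j) :
    n % 2 = r := by
  have hp := hh.segment_isPath hn hnk
  have hx : ∀ i : Fin (n + 1), ∃ x, h ⟨s + i, by omega⟩ = .inl x := fun i =>
    hinl _ (by simp) (by simp only; omega)
  choose x hx using hx
  have hq := hp.of_addMarkers hx
  have hA : ∀ i : Fin (n + 1), (x i : V) ∈ A ↔ CyclicConsec k ia (s + i) := fun i =>
    ha ▸ hh.marker_mem hia (hx i)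
  have hB : ∀ i : Fin (n + 1), (x i : V) ∈ B ↔ CyclicConsec k ib (s + i) := fun i =>
    hb ▸ hh.marker_mem hib (hx i)
  have hC : ∀ i : Fin (n + 1), i ≠ 0 → i ≠ Fin.last n → (x i : V) ∈ C := by
    intro i h0 hl
    have h0' : (i : ℕ) ≠ 0 := fun e => h0 (Fin.ext e)
    have hl' : (i : ℕ) ≠ n := fun e => hl (Fin.ext e)
    have := hint (s + i) (by omega) (by omega)
    rw [← hA, ← hB] at this
    have hxX : (x i : V) ∈ A ∪ B ∪ C := hX.subset (x i).2
    rcases hxX with (h1 | h1) | h1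
    · exact absurd h1 this.1
    · exact absurd h1 this.2
    · exact h1
  rcases hends with ⟨h1, h2⟩ | ⟨h1, h2⟩
  · exact hpar n _ ⟨hq, (hA 0).2 h1, (hB (Fin.last n)).2 h2, hC⟩
  · refine hpar n _ ⟨hq.rev, ?_, ?_, fun i h0 hl => hC _ ?_ ?_⟩
    · simpa using (hA (Fin.last n)).2 h2
    · simpa using (hB 0).2 h1
    · rwa [Ne, Fin.rev_eq_iff, Fin.rev_zero]
    · rwa [Ne, Fin.rev_eq_iff, Fin.rev_last]

end Markers

/-! ### Linking paths -/

/-- A shortest walk from `A` to `B` inside `X` is a linking path. -/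
theorem ComponentsMeet.exists_isLinkingPath {T : Trigraph V} {X A B C : Set V}
    (h : T.ComponentsMeet X A B) (hX : X = A ∪ B ∪ C) (hA : A.Nonempty) :
    ∃ (n : ℕ) (p : Fin (n + 1) → V), T.IsLinkingPath A B C p := by
  classical
  let G := (T.induce X).fullRealization
  -- The length is minimised over all choices of both ends as well, which later keeps interior
  -- vertices out of `A` and `B`.
  let P : ℕ → Prop := fun n => ∃ x y : X, (x : V) ∈ A ∧ (y : V) ∈ B ∧
    ∃ w : G.Walk x y, w.length = n
  have hP : ∃ n, P n := by
    obtain ⟨x, hx⟩ := hA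
    have hxX : x ∈ X := hX ▸ Or.inl (Or.inl hx)
    obtain ⟨y, hy, hyB⟩ := (h (G.connectedComponentMk ⟨x, hxX⟩)).2
    obtain ⟨w⟩ := (SimpleGraph.ConnectedComponent.exact hy).symm
    exact ⟨_, ⟨x, hxX⟩, y, hx, hyB, w, rfl⟩
  obtain ⟨x, y, hx, hy, w, hw⟩ := Nat.find_spec hP
  have hmin : ∀ m, P m → Nat.find hP ≤ m := fun m hm => Nat.find_min' hP hm
  generalize Nat.find hP = n at *
  -- Splicing `u` in place of the stretch from `i` to `j` cannot shorten the walk. A trivial `u`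
  -- gives injectivity, a single edge excludes chords.
  have hshort : ∀ i j, i ≤ n → j ≤ n → ∀ u : G.Walk (w.getVert i) (w.getVert j),
      j ≤ i + u.length := by
    intro i j hi hj u
    have := hmin _ ⟨x, y, hx, hy, ((w.take i).append u).append (w.drop j), rfl⟩
    simp only [SimpleGraph.Walk.length_append, SimpleGraph.Walk.take_length,
      SimpleGraph.Walk.drop_length, hw] at this
    omega
  have hinj : Function.Injective (fun i : Fin (n + 1) => (w.getVert i : V)) := by
    have key : ∀ i j : Fin (n + 1), (w.getVert i : V) = w.getVert j → (j : ℕ) ≤ i := by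
      intro i j hij
      have := hshort i j (by omega) (by omega) (SimpleGraph.Walk.nil.copy rfl (Subtype.ext hij))
      simpa using this
    exact fun i j hij => Fin.ext (le_antisymm (key j i hij.symm) (key i j hij))
  have hTadj : ∀ a b : X, T.Adj a b ↔ G.Adj a b := by
    intro a b
    change _ ↔ (T.induce X).Adj a b
    rw [adj_iff, adj_iff]
    exact and_congr_left' (not_congr Subtype.ext_iff.symm)
  refine ⟨n, fun i => w.getVert i, ⟨hinj, fun i j hij => ?_, fun i j hij => ?_⟩, ?_, ?_, ?_⟩
  · rw [hTadj]
    have := w.adj_getVert_succ (i := i) (by omega)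
    rwa [hij] at this
  · by_contra hna
    have hne : (w.getVert i : V) ≠ w.getVert j := fun e => by
      have := congrArg Fin.val (hinj e)
      omega
    have hadj : T.Adj (w.getVert i) (w.getVert j) := by
      rw [adj_iff]
      refine ⟨hne, fun e => hna ((antiadj_iff _).2 ⟨hne, by rw [e]; decide⟩)⟩
    have := hshort i j (by omega) (by omega) ((hTadj _ _).1 hadj).toWalk
    simp only [SimpleGraph.Walk.length_cons, SimpleGraph.Walk.length_nil] at this
    omega
  · simpa using hx
  · simpa [← hw] using hy
  · intro i h0 hl
    have h0' : (i : ℕ) ≠ 0 := fun e => h0 (Fin.ext e)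
    have hl' : (i : ℕ) ≠ n := fun e => hl (Fin.ext e)
    have hm : (w.getVert i : V) ∈ A ∪ B ∪ C := hX.subset (w.getVert i).2
    rcases hm with (hm | hm) | hm
    · have := hmin _ ⟨_, y, hm, hy, w.drop i, rfl⟩
      rw [SimpleGraph.Walk.drop_length] at this
      omega
    · have := hmin _ ⟨x, _, hx, hm, w.take i, rfl⟩
      rw [SimpleGraph.Walk.take_length] at this
      omega
    · exact hm

theorem IsSplit.not_mem₂ {T : Trigraph V} {X₁ X₂ A₁ B₁ C₁ A₂ B₂ C₂ : Set V}
    (hs : T.IsSplit X₁ X₂ A₁ B₁ C₁ A₂ B₂ C₂) {x : V} (hx : x ∈ X₂) : x ∉ X₁ := by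
  rw [hs.partition] at hx
  exact hx

theorem IsSplit.antiadj {T : Trigraph V} {X₁ X₂ A₁ B₁ C₁ A₂ B₂ C₂ : Set V}
    (hs : T.IsSplit X₁ X₂ A₁ B₁ C₁ A₂ B₂ C₂) {x y : V} (hx : x ∈ X₁) (hy : y ∈ X₂)
    (h : ¬ ((x ∈ A₁ ∧ y ∈ A₂) ∨ (x ∈ B₁ ∧ y ∈ B₂))) : T.StrongAntiadj x y := by
  have hne : x ≠ y := fun e => hs.not_mem₂ hy (e ▸ hx)
  refine ⟨hne, ?_⟩
  have h1 : T.θ x y ≠ 0 := fun e => hs.no_switch x hx y hy ⟨hne, e⟩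
  have h2 : T.θ x y ≠ 1 := fun e => h (hs.no_other x hx y hy ⟨hne, e⟩)
  generalize T.θ x y = s at *
  revert s
  decide

/-- Disjointness turns membership in `A` or `B` into a statement about positions, so adjacency
across the 2-join becomes arithmetic. -/
theorem IsLinkingPath.mem_iff {T : Trigraph V} {A B C : Set V} {n : ℕ} {p : Fin (n + 1) → V}
    (hp : T.IsLinkingPath A B C p) (hd : Disjoint A B ∧ Disjoint A C ∧ Disjoint B C)
    (i : Fin (n + 1)) :
    p i ∈ A ∪ B ∪ C ∧ (p i ∈ A ↔ (i : ℕ) = 0) ∧ (p i ∈ B ↔ (i : ℕ) = n) := by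
  obtain ⟨-, hA, hB, hC⟩ := hp
  have h0 : (i : ℕ) = 0 → p i ∈ A := fun e => by rwa [show i = 0 from Fin.ext e]
  have hl : (i : ℕ) = n → p i ∈ B := fun e => by rwa [show i = Fin.last n from Fin.ext e]
  have hi : (i : ℕ) ≠ 0 → (i : ℕ) ≠ n → p i ∈ C := fun e e' =>
    hC i (fun h => e (by simp [h])) (fun h => e' (by simp [h]))
  have h4 := fun h : p i ∈ A => Set.disjoint_left.1 hd.1 h
  have h5 := fun h : p i ∈ A => Set.disjoint_left.1 hd.2.1 h
  have h6 := fun h : p i ∈ B => Set.disjoint_left.1 hd.2.2 h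
  simp only [Set.mem_union]
  tauto

/-- Linking paths on the two sides of a 2-join of a Berge trigraph together form a hole, so their
lengths have the same parity. -/
theorem IsSplit.linking_parity {T : Trigraph V} (hT : T.IsBerge)
    {X₁ X₂ A₁ B₁ C₁ A₂ B₂ C₂ : Set V} (hs : T.IsSplit X₁ X₂ A₁ B₁ C₁ A₂ B₂ C₂) {m n : ℕ}
    {p : Fin (m + 1) → V} {q : Fin (n + 1) → V} (hp : T.IsLinkingPath A₁ B₁ C₁ p)
    (hq : T.IsLinkingPath A₂ B₂ C₂ q) : m % 2 = n % 2 := by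
  have hpm := fun i => hp.mem_iff hs.disj₁ i
  have hqm := fun i => hq.mem_iff hs.disj₂ i
  simp only [← hs.eq₁] at hpm
  simp only [← hs.eq₂] at hqm
  have hm0 : m ≠ 0 := by
    rintro rfl
    have := hpm 0
    exact Set.disjoint_left.1 hs.disj₁.1 (this.2.1.2 rfl) (this.2.2.2 rfl)
  have hn0 : n ≠ 0 := by
    rintro rfl
    have := hqm 0
    exact Set.disjoint_left.1 hs.disj₂.1 (this.2.1.2 rfl) (this.2.2.2 rfl)
  -- Traverse `p` forwards and then `q` backwards: the junction `m`, `m + 1` joins `B₁` to `B₂`, and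
  -- the closing edge joins `A₂` to `A₁`.
  let h : Fin (m + n + 2) → V := fun i =>
    if hi : (i : ℕ) ≤ m then p ⟨i, by omega⟩ else q ⟨m + n + 1 - i, by omega⟩
  have hhp : ∀ (i : Fin (m + n + 2)) (hi : (i : ℕ) ≤ m), h i = p ⟨i, by omega⟩ :=
    fun i hi => dif_pos hi
  have hhq : ∀ (i : Fin (m + n + 2)) (hi : ¬ (i : ℕ) ≤ m), h i = q ⟨m + n + 1 - i, by omega⟩ :=
    fun i hi => dif_neg hi
  have hinj : Function.Injective h := by
    intro i j hij
    by_cases hi : (i : ℕ) ≤ m <;> by_cases hj : (j : ℕ) ≤ m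
    · rw [hhp i hi, hhp j hj] at hij
      have := congrArg Fin.val (hp.1.1 hij)
      exact Fin.ext this
    · rw [hhp i hi, hhq j hj] at hij
      exact absurd (hij ▸ (hpm _).1) (hs.not_mem₂ (hqm _).1)
    · rw [hhq i hi, hhp j hj] at hij
      exact absurd (hij.symm ▸ (hpm _).1) (hs.not_mem₂ (hqm _).1)
    · rw [hhq i hi, hhq j hj] at hij
      have := congrArg Fin.val (hq.1.1 hij)
      simp only at this
      exact Fin.ext (by omega)
  have hhole : T.IsHole h := by
    refine ⟨by omega, hinj, fun i j hij => ?_, fun i j h1 h2 => ?_⟩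
    · by_cases hi : (i : ℕ) ≤ m <;> by_cases hj : (j : ℕ) ≤ m
      · rw [hhp i hi, hhp j hj]
        exact hp.1.2.1 _ _ (by simp only; omega)
      · rw [hhp i hi, hhq j hj]
        rcases hij with hij | hij
        · exact Or.inl (hs.complete_B _ ((hpm _).2.2.2 (by simp only; omega)) _
            ((hqm _).2.2.2 (by simp only; omega)))
        · exact Or.inl (hs.complete_A _ ((hpm _).2.1.2 (by simp only; omega)) _
            ((hqm _).2.1.2 (by simp only; omega)))
      · omega
      · rw [hhq i hi, hhq j hj]
        exact (hq.1.2.1 _ _ (by simp only; omega)).symm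
    · by_cases hi : (i : ℕ) ≤ m <;> by_cases hj : (j : ℕ) ≤ m
      · rw [hhp i hi, hhp j hj]
        exact hp.1.2.2 _ _ (by simp only; omega)
      · rw [hhp i hi, hhq j hj]
        refine Or.inl (hs.antiadj (hpm _).1 (hqm _).1 ?_)
        rw [(hpm _).2.1, (hpm _).2.2, (hqm _).2.1, (hqm _).2.2]
        simp only
        omega
      · omega
      · rw [hhq i hi, hhq j hj]
        exact (hq.1.2.2 _ _ (by simp only; omega)).symm
  by_contra hne
  exact (hT _ h (Nat.odd_iff.2 (by omega))).1 hhole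

/-- The path that fixes the parity may lie on the same side as `p`; both are then compared with a
linking path of the other side, which properness supplies. -/
theorem IsProperSplit.linking_parity {T : Trigraph V} (hT : T.IsBerge)
    {X₁ X₂ A₁ B₁ C₁ A₂ B₂ C₂ : Set V} (hs : T.IsProperSplit X₁ X₂ A₁ B₁ C₁ A₂ B₂ C₂) {l : ℕ}
    (hl : T.HasLinkingPath A₁ B₁ C₁ A₂ B₂ C₂ l) (n : ℕ) (p : Fin (n + 1) → V)
    (hp : T.IsLinkingPath A₁ B₁ C₁ p) : n % 2 = l % 2 := by
  obtain ⟨q, hq | hq⟩ := hl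
  · obtain ⟨m, r, hr⟩ := hs.2.2.exists_isLinkingPath hs.1.eq₂ hs.1.nonempty₂.1
    rw [hs.1.linking_parity hT hp hr, hs.1.linking_parity hT hq hr]
  · exact hs.1.linking_parity hT hp hq

/-! ### Blocks of 2-joins are Berge -/

section Berge

variable {T : Trigraph V} {X A₁ B₁ C₁ A₂ B₂ C₂ : Set V} {M : Trigraph W} {N : W → Set V}
  {a b : W}

/-- Any vertex of `A₂` stands in for `a`, any vertex of `B₂` for `b`: no switchable pair crosses the
2-join, so their pairs with `X` are all strong. -/
theorem IsSplit.exists_mimic (hs : T.IsSplit X Xᶜ A₁ B₁ C₁ A₂ B₂ C₂) (ha : N a = A₁)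
    (hb : N b = B₁) {w : W} (hw : w = a ∨ w = b) :
    ∃ v ∉ X, ∀ x ∈ X, (x ∈ N w → T.θ x v = 1) ∧ (x ∉ N w → T.θ x v = -1) := by
  rcases hw with rfl | rfl
  · obtain ⟨v, hv⟩ := hs.nonempty₂.1
    have hvX : v ∈ Xᶜ := by
      rw [hs.eq₂]
      exact Or.inl (Or.inl hv)
    refine ⟨v, hvX, fun x hx => ⟨fun h => (hs.complete_A x (ha ▸ h) v hv).2, fun h => ?_⟩⟩
    refine (hs.antiadj hx hvX ?_).2
    rintro (⟨h', -⟩ | ⟨-, h'⟩)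
    · exact h (ha ▸ h')
    · exact Set.disjoint_left.1 hs.disj₂.1 hv h'
  · obtain ⟨v, hv⟩ := hs.nonempty₂.2
    have hvX : v ∈ Xᶜ := by
      rw [hs.eq₂]
      exact Or.inl (Or.inr hv)
    refine ⟨v, hvX, fun x hx => ⟨fun h => (hs.complete_B x (hb ▸ h) v hv).2, fun h => ?_⟩⟩
    refine (hs.antiadj hx hvX ?_).2
    rintro (⟨-, h'⟩ | ⟨h', -⟩)
    · exact Set.disjoint_left.1 hs.disj₂.1 h' hv
    · exact h (hb ▸ h')

/-- If a hole or antihole only meets the markers `a` and `b` and is odd, then it contains both. -/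
theorem IsSplit.exists_markers_of_odd (hT : T.IsBerge) (hs : T.IsSplit X Xᶜ A₁ B₁ C₁ A₂ B₂ C₂)
    (ha : N a = A₁) (hb : N b = B₁) {k : ℕ} (hk : Odd k) {h : Fin k → X ⊕ W}
    (hmk : ∀ i w, h i = .inr w → w = a ∨ w = b)
    (hh : (T.addMarkers X M N).IsHole h ∨ (T.addMarkers X M N).IsAntihole h) :
    (∃ i, h i = .inr a) ∧ ∃ i, h i = .inr b := by
  by_contra hcon
  have hinj : Function.Injective h := hh.elim (fun h => h.2.1) (fun h => h.2.1)
  have := hT.not_isHole_addMarkers (X := X) (M := M) (N := N) hk (h := h) ?_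
    fun i w hi => hs.exists_mimic ha hb (hmk i w hi)
  · exact hh.elim this.1 this.2
  · intro i j w w' hi hj
    have : w = w' := by
      rcases hmk i w hi with rfl | rfl <;> rcases hmk j w' hj with rfl | rfl
      · rfl
      · exact absurd ⟨⟨i, hi⟩, ⟨j, hj⟩⟩ hcon
      · exact absurd ⟨⟨j, hj⟩, ⟨i, hi⟩⟩ hcon
      · rfl
    exact hinj (by rw [hi, hj, this])

/-- If `a` and `b` are consecutive, the rest of the hole is a linking path of even length `k - 3`,
which `hr` forbids. Otherwise it splits into two linking paths of equal parity whose lengths sum to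
the odd number `k - 4`. -/
theorem IsSplit.not_isHole_of_markers (hT : T.IsBerge)
    (hs : T.IsSplit X Xᶜ A₁ B₁ C₁ A₂ B₂ C₂) {r : ℕ}
    (hpar : ∀ (n : ℕ) (p : Fin (n + 1) → V), T.IsLinkingPath A₁ B₁ C₁ p → n % 2 = r)
    (ha : N a = A₁) (hb : N b = B₁) (hab : a ≠ b) (hr : r = 1 ∨ ¬ M.Adj a b) {k : ℕ} (hk : Odd k)
    {h : Fin k → X ⊕ W} (hmk : ∀ i w, h i = .inr w → w = a ∨ w = b) :
    ¬ (T.addMarkers X M N).IsHole h := by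
  intro hh
  obtain ⟨⟨i, hi⟩, ⟨j, hj⟩⟩ := hs.exists_markers_of_odd hT ha hb hk hmk (.inl hh)
  obtain ⟨g, hg, hrange, h0⟩ := hh.exists_start i
  have hmk' : ∀ i w, g i = .inr w → w = a ∨ w = b := by
    intro i w hi
    obtain ⟨l, hl⟩ : g i ∈ Set.range h := hrange ▸ ⟨i, rfl⟩
    exact hmk l w (hl.trans hi)
  obtain ⟨m, hm⟩ : (.inr b : X ⊕ W) ∈ Set.range g := hrange ▸ ⟨j, hj⟩
  clear hmk hrange
  have hk4 := hg.1
  have hk2 := Nat.odd_iff.1 hk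
  obtain ⟨z, hz0, hz⟩ : ∃ z : Fin k, (z : ℕ) = 0 ∧ g z = .inr a :=
    ⟨⟨0, by omega⟩, rfl, (h0 _ rfl).trans hi⟩
  have hm0 : (m : ℕ) ≠ 0 := fun e => by
    rw [show m = z from Fin.ext (e.trans hz0.symm), hz] at hm
    exact hab (Sum.inr_injective hm)
  have hinl : ∀ l : Fin k, (l : ℕ) ≠ 0 → l ≠ (m : ℕ) → ∃ x, g l = .inl x := by
    intro l h0 hlm
    rcases hl : g l with x | w
    · exact ⟨x, rfl⟩
    · rcases hmk' l w hl with rfl | rfl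
      · exact absurd ((congrArg Fin.val (hg.2.1 (hl.trans hz.symm))).trans hz0) h0
      · exact absurd (congrArg Fin.val (hg.2.1 (hl.trans hm.symm))) hlm
  have hmk := m.2
  by_cases hc : CyclicConsec k z m
  · have hadj : M.Adj a b := by
      have := hg.adj (i := z) (j := m) hc
      rw [hz, hm] at this
      rw [adj_iff] at this ⊢
      exact ⟨hab, this.2⟩
    have hr1 : r = 1 := hr.resolve_right (not_not.2 hadj)
    have hcase : (m : ℕ) = 1 ∨ (m : ℕ) = k - 1 := by
      unfold CyclicConsec at hc
      omega
    -- With `a` at position `0`, the remaining segment starts at `2` or at `1`, according to the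
    -- side on which `b` sits.
    rcases hcase with h1 | h1
    · have := hg.segment_parity hpar hs.eq₁ ha hb hz hm (s := 2) (n := k - 3) (by omega) (by omega)
        (fun l hl hl' => hinl l (by omega) (by omega))
        (by unfold CyclicConsec; omega)
        (by unfold CyclicConsec; omega)
      omega
    · have := hg.segment_parity hpar hs.eq₁ ha hb hz hm (s := 1) (n := k - 3) (by omega) (by omega)
        (fun l hl hl' => hinl l (by omega) (by omega))
        (by unfold CyclicConsec; omega)
        (by unfold CyclicConsec; omega)
      omega
  · unfold CyclicConsec at hc
    have h1 := hg.segment_parity hpar hs.eq₁ ha hb hz hm (s := 1) (n := m - 2) (by omega) (by omega)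
      (fun l hl hl' => hinl l (by omega) (by omega))
      (by unfold CyclicConsec; omega)
      (by unfold CyclicConsec; omega)
    have h2 := hg.segment_parity hpar hs.eq₁ ha hb hz hm (s := m + 1) (n := k - 2 - m)
      (by omega) (by omega)
      (fun l hl hl' => hinl l (by omega) (by omega))
      (by unfold CyclicConsec; omega)
      (by unfold CyclicConsec; omega)
    omega

theorem IsSplit.not_isAntihole_of_markers (hT : T.IsBerge)
    (hs : T.IsSplit X Xᶜ A₁ B₁ C₁ A₂ B₂ C₂) (ha : N a = A₁) (hb : N b = B₁) (hab : a ≠ b)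
    {k : ℕ} (hk : Odd k) (hk7 : 7 ≤ k) {h : Fin k → X ⊕ W}
    (hmk : ∀ i w, h i = .inr w → w = a ∨ w = b) : ¬ (T.addMarkers X M N).IsAntihole h := by
  intro hh
  obtain ⟨⟨i, hi⟩, ⟨j, hj⟩⟩ := hs.exists_markers_of_odd hT ha hb hk hmk (.inr hh)
  obtain ⟨g, hg, hrange, h0⟩ := IsHole.exists_start hh i
  obtain ⟨m, hm⟩ : (.inr b : X ⊕ W) ∈ Set.range g := hrange ▸ ⟨j, hj⟩
  have hz : g ⟨0, by omega⟩ = .inr a := (h0 _ rfl).trans hi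
  have hm0 : (m : ℕ) ≠ 0 := fun e => by
    rw [show m = ⟨0, by omega⟩ from Fin.ext e, hz] at hm
    exact hab (Sum.inr_injective hm)
  -- Positions `0` and `m` with their cyclic neighbours exclude at most six of at least seven
  -- positions. The vertex at a remaining one is adjacent to both `a` and `b` in the block.
  obtain ⟨l, hl0, hlm, hlc0, hlcm⟩ : ∃ l : Fin k, (l : ℕ) ≠ 0 ∧ (m : ℕ) ≠ l ∧
      ¬ CyclicConsec k 0 l ∧ ¬ CyclicConsec k m l := by
    unfold CyclicConsec
    by_cases h1 : (m : ℕ) ≤ 2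
    · exact ⟨⟨4, by omega⟩, by simp only; omega⟩
    · by_cases h2 : (m : ℕ) = 3
      · exact ⟨⟨5, by omega⟩, by simp only; omega⟩
      · exact ⟨⟨2, by omega⟩, by simp only; omega⟩
  have hadj0 := hg.antiadj (i := ⟨0, by omega⟩) (j := l) (fun e => hl0 e.symm) hlc0
  have hadjm := hg.antiadj hlm hlcm
  rw [compl_antiadj, hz] at hadj0
  rw [compl_antiadj, hm] at hadjm
  rcases hl : g l with x | w
  · rw [hl, addMarkers_adj_inr_inl, ha] at hadj0
    rw [hl, addMarkers_adj_inr_inl, hb] at hadjm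
    exact Set.disjoint_left.1 hs.disj₁.1 hadj0 hadjm
  · obtain ⟨l', hl'⟩ : g l ∈ Set.range h := hrange ▸ ⟨l, rfl⟩
    rcases hmk l' w (hl'.trans hl) with rfl | rfl
    · exact ((adj_iff _).1 hadj0).1 hl.symm
    · exact ((adj_iff _).1 hadjm).1 hl.symm

/-- A trigraph without odd holes is Berge if it has no odd antihole of length at least seven. -/
theorem isBerge_of_not_isHole {T : Trigraph V}
    (hhole : ∀ (k : ℕ) (h : Fin k → V), Odd k → ¬ T.IsHole h)
    (hanti : ∀ (k : ℕ) (h : Fin k → V), Odd k → 7 ≤ k → ¬ T.IsAntihole h) : T.IsBerge := by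
  refine fun k h hk => ⟨hhole k h hk, fun hh => ?_⟩
  by_cases h7 : 7 ≤ k
  · exact hanti k h hk h7 hh
  · have h4 := hh.1
    have h2 := Nat.odd_iff.1 hk
    obtain rfl : k = 5 := by omega
    obtain ⟨h', hh', -⟩ := hh.exists_isHole_five
    exact hhole 5 h' hk hh'

theorem IsProperSplit.oddBlock_isBerge (hT : T.IsBerge)
    (hs : T.IsProperSplit X Xᶜ A₁ B₁ C₁ A₂ B₂ C₂) (hp : T.IsOddSplit A₁ B₁ C₁ A₂ B₂ C₂) :
    (T.oddBlock X A₁ B₁).IsBerge := by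
  obtain ⟨l, hl, hlink⟩ := hp
  have hpar := hs.linking_parity hT hlink
  have hmk : ∀ w : OddMarker, w = .a ∨ w = .b := by rintro (_ | _) <;> simp
  refine isBerge_of_not_isHole (fun k h hk => ?_) (fun k h hk h7 => ?_)
  · exact hs.1.not_isHole_of_markers hT hpar (a := OddMarker.a) (b := .b) rfl rfl (by simp)
      (.inl (Nat.odd_iff.1 hl)) hk fun _ w _ => hmk w
  · exact hs.1.not_isAntihole_of_markers hT (a := OddMarker.a) (b := .b) rfl rfl (by simp) hk h7
      fun _ w _ => hmk w

theorem evenBlock_eq_of_adj_c {A B : Set V} {y : X ⊕ EvenMarker}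
    (h : (T.evenBlock X A B).Adj (.inr .c) y) : y = .inr .a ∨ y = .inr .b := by
  rcases y with x | _ | _ | _
  · exact absurd (addMarkers_adj_inr_inl.1 h) (Set.notMem_empty _)
  · exact .inl rfl
  · exact .inr rfl
  · exact absurd rfl ((adj_iff _).1 h).1

theorem IsProperSplit.evenBlock_isBerge (hT : T.IsBerge)
    (hs : T.IsProperSplit X Xᶜ A₁ B₁ C₁ A₂ B₂ C₂) (hp : T.IsEvenSplit A₁ B₁ C₁ A₂ B₂ C₂) :
    (T.evenBlock X A₁ B₁).IsBerge := by
  obtain ⟨l, hl, hlink⟩ := hp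
  have hpar := hs.linking_parity hT hlink
  rw [Nat.even_iff.1 hl] at hpar
  have hmk : ∀ {k : ℕ} {h : Fin k → X ⊕ EvenMarker}, (¬ ∃ i, h i = .inr .c) →
      ∀ i w, h i = .inr w → w = .a ∨ w = .b := by
    rintro k h hc i (_ | _ | _) hi
    · exact .inl rfl
    · exact .inr rfl
    · exact absurd ⟨i, hi⟩ hc
  refine isBerge_of_not_isHole (fun k h hk hh => ?_) (fun k h hk h7 hh => ?_)
  · by_cases hc : ∃ i, h i = .inr .c
    · obtain ⟨i, hi⟩ := hc
      obtain ⟨g, hg, -, h0⟩ := hh.exists_start i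
      have hk4 := hg.1
      have hk2 := Nat.odd_iff.1 hk
      have hz : g ⟨0, by omega⟩ = .inr .c := (h0 _ rfl).trans hi
      have h1 := hg.adj (i := ⟨0, by omega⟩) (j := ⟨1, by omega⟩) (.inl rfl)
      have h2 := hg.adj (i := ⟨0, by omega⟩) (j := ⟨k - 1, by omega⟩)
        (by unfold CyclicConsec; simp only; omega)
      rw [hz] at h1 h2
      have hne : g ⟨1, by omega⟩ ≠ g ⟨k - 1, by omega⟩ := fun e => by
        have := congrArg Fin.val (hg.2.1 e)
        simp only at this
        omega
      -- With `c` at position `0` and `a`, `b` on either side of it, positions `2` to `k - 2` form a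
      -- linking path of odd length `k - 4`, while linking paths here are even.
      have key : ∀ ia ib : Fin k, ((ia : ℕ) = 1 ∧ (ib : ℕ) = k - 1 ∨ (ia : ℕ) = k - 1 ∧ (ib : ℕ) = 1) →
          g ia = .inr .a → g ib = .inr .b → False := by
        intro ia ib hiab ha hb
        have := IsHole.segment_parity hpar hs.1.eq₁ (a := EvenMarker.a) (b := .b) rfl rfl hg ha hb
          (s := 2) (n := k - 4) (by omega) (by omega) ?_
          (by unfold CyclicConsec; omega)
          (by unfold CyclicConsec; omega)
        · omega
        · intro j hj hj'
          rcases hjx : g j with x | _ | _ | _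
          · exact ⟨x, rfl⟩
          · have := congrArg Fin.val (hg.2.1 (hjx.trans ha.symm))
            omega
          · have := congrArg Fin.val (hg.2.1 (hjx.trans hb.symm))
            omega
          · have := congrArg Fin.val (hg.2.1 (hjx.trans hz.symm))
            simp only at this
            omega
      rcases evenBlock_eq_of_adj_c h1 with e1 | e1 <;> rcases evenBlock_eq_of_adj_c h2 with e2 | e2
      · exact hne (e1.trans e2.symm)
      · exact key _ _ (.inl ⟨rfl, rfl⟩) e1 e2
      · exact key _ _ (.inr ⟨rfl, rfl⟩) e2 e1
      · exact hne (e1.trans e2.symm)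
    · exact hs.1.not_isHole_of_markers hT hpar (a := EvenMarker.a) (b := .b) rfl rfl (by simp)
        (.inr fun h => ((adj_iff _).1 h).2 rfl) hk (hmk hc) hh
  · by_cases hc : ∃ i, h i = .inr .c
    · obtain ⟨i, hi⟩ := hc
      obtain ⟨g, hg, -, h0⟩ := IsHole.exists_start hh i
      have hz : g ⟨0, by omega⟩ = .inr .c := (h0 _ rfl).trans hi
      -- Since `k ≥ 7`, positions `2`, `3`, `4` are not consecutive to `0` in the antihole, so three
      -- distinct vertices would be neighbours of `c`, which has only two.
      have hadj : ∀ j : Fin k, 2 ≤ (j : ℕ) → (j : ℕ) ≤ 4 → g j = .inr .a ∨ g j = .inr .b := by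
        intro j hj hj'
        have := hg.antiadj (i := ⟨0, by omega⟩) (j := j) (by simp only; omega)
          (by unfold CyclicConsec; simp only; omega)
        rw [compl_antiadj, hz] at this
        exact evenBlock_eq_of_adj_c this
      have hne : ∀ (i j : ℕ) (hi : i < k) (hj : j < k), i ≠ j → g ⟨i, hi⟩ ≠ g ⟨j, hj⟩ :=
        fun i j hi hj hij e => hij (congrArg Fin.val (hg.2.1 e))
      have n1 := hne 2 3 (by omega) (by omega) (by omega)
      have n2 := hne 2 4 (by omega) (by omega) (by omega)
      have n3 := hne 3 4 (by omega) (by omega) (by omega)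
      rcases hadj ⟨2, by omega⟩ (by simp) (by simp) with e1 | e1 <;>
      rcases hadj ⟨3, by omega⟩ (by simp) (by simp) with e2 | e2 <;>
      rcases hadj ⟨4, by omega⟩ (by simp) (by simp) with e3 | e3 <;>
      simp_all
    · exact hs.1.not_isAntihole_of_markers hT (a := EvenMarker.a) (b := .b) rfl rfl (by simp) hk h7
        (hmk hc) hh

end Berge

/-! ### Blocks of 2-joins are in the class -/

section Class

variable {T : Trigraph V} {X A₁ B₁ C₁ A₂ B₂ C₂ : Set V} {M : Trigraph W} {N : W → Set V}

theorem reachable_of_addMarkers {x : X} {z : X ⊕ W}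
    (h : (T.addMarkers X M N).switchGraph.Reachable (.inl x) z) :
    ∃ y : X, z = .inl y ∧ T.switchGraph.Reachable x y := by
  rw [SimpleGraph.reachable_iff_reflTransGen] at h
  induction h with
  | refl => exact ⟨x, rfl, .refl _⟩
  | @tail z z' _ hz ih =>
    obtain ⟨y, rfl, hy⟩ := ih
    rcases z' with y' | w
    · exact ⟨y', rfl, hy.trans (SimpleGraph.Adj.reachable (addMarkers_semiadj_inl_inl.1 hz))⟩
    · exact absurd hz addMarkers_not_semiadj_inl_inr

theorem reachable_marker_of_addMarkers {w : W} {z : X ⊕ W}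
    (h : (T.addMarkers X M N).switchGraph.Reachable (.inr w) z) : ∃ w', z = .inr w' := by
  rw [SimpleGraph.reachable_iff_reflTransGen] at h
  induction h with
  | refl => exact ⟨w, rfl⟩
  | @tail z z' _ hz ih =>
    obtain ⟨w', rfl⟩ := ih
    rcases z' with y | w''
    · exact absurd hz addMarkers_not_semiadj_inr_inl
    · exact ⟨w'', rfl⟩

/-- A switchable component in `X` sits inside a component of `T.switchGraph`, and any other consists
of markers only. -/
theorem addMarkers_edges_le_two
    (hT : ∀ c : T.switchGraph.ConnectedComponent,
      {e ∈ T.switchGraph.edgeSet | ∀ w ∈ e, w ∈ c.supp}.encard ≤ 2)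
    (hM : M.switchGraph.edgeSet.encard ≤ 2)
    (c : (T.addMarkers X M N).switchGraph.ConnectedComponent) :
    {e ∈ (T.addMarkers X M N).switchGraph.edgeSet | ∀ w ∈ e, w ∈ c.supp}.encard ≤ 2 := by
  induction c using SimpleGraph.ConnectedComponent.ind with | _ v
  have hsupp : ∀ z, z ∈ ((T.addMarkers X M N).switchGraph.connectedComponentMk v).supp →
      (T.addMarkers X M N).switchGraph.Reachable v z := fun z hz =>
    (SimpleGraph.ConnectedComponent.exact hz).symm
  rcases v with x | m
  · let E : Set (Sym2 X) := Sym2.map (fun x : X => (x : V)) ⁻¹'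
      {e ∈ T.switchGraph.edgeSet | ∀ w ∈ e, w ∈ (T.switchGraph.connectedComponentMk x).supp}
    have h1 : {e ∈ (T.addMarkers X M N).switchGraph.edgeSet | ∀ w ∈ e,
        w ∈ ((T.addMarkers X M N).switchGraph.connectedComponentMk (.inl x)).supp} ⊆
        Sym2.map Sum.inl '' E := by
      rintro e ⟨he, hec⟩
      induction e using Sym2.ind with | _ p q
      obtain ⟨y, rfl, hy⟩ := reachable_of_addMarkers (hsupp p (hec p (by simp)))
      obtain ⟨y', rfl, hy'⟩ := reachable_of_addMarkers (hsupp q (hec q (by simp)))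
      refine ⟨s(y, y'), ⟨?_, ?_⟩, rfl⟩
      · exact addMarkers_semiadj_inl_inl.1 he
      · intro w hw
        rcases Sym2.mem_iff.1 hw with rfl | rfl
        · exact SimpleGraph.ConnectedComponent.sound hy.symm
        · exact SimpleGraph.ConnectedComponent.sound hy'.symm
    calc _ ≤ (Sym2.map Sum.inl '' E : Set (Sym2 (X ⊕ W))).encard := Set.encard_le_encard h1
      _ ≤ E.encard := Set.encard_image_le _ _
      _ = (Sym2.map (fun x : X => (x : V)) '' E).encard :=
        ((Sym2.map.injective Subtype.val_injective).encard_image _).symm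
      _ ≤ _ := Set.encard_le_encard (Set.image_preimage_subset _ _)
      _ ≤ 2 := hT _
  · have h1 : {e ∈ (T.addMarkers X M N).switchGraph.edgeSet | ∀ w ∈ e,
        w ∈ ((T.addMarkers X M N).switchGraph.connectedComponentMk (.inr m)).supp} ⊆
        Sym2.map Sum.inr '' M.switchGraph.edgeSet := by
      rintro e ⟨he, hec⟩
      induction e using Sym2.ind with | _ p q
      obtain ⟨w, rfl⟩ := reachable_marker_of_addMarkers (hsupp p (hec p (by simp)))
      obtain ⟨w', rfl⟩ := reachable_marker_of_addMarkers (hsupp q (hec q (by simp)))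
      exact ⟨s(w, w'), addMarkers_semiadj_inr_inr.1 he, rfl⟩
    exact (Set.encard_le_encard h1).trans ((Set.encard_image_le _ _).trans hM)

/-- The conclusion is always light. The assumption `hN` matters for a light vertex of `X`: being
outside `A₁ ∪ B₁`, it is strongly antiadjacent to every marker. -/
theorem IsSplit.addMarkers_heavy_or_light (hs : T.IsSplit X Xᶜ A₁ B₁ C₁ A₂ B₂ C₂)
    (hT : ∀ v x y : V, x ≠ y → T.switchGraph.neighborSet v = {x, y} →
      T.IsHeavy v x y ∨ T.IsLight v x y)
    (hN : ∀ w, N w ⊆ A₁ ∪ B₁)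
    (hM : ∀ v x y : W, x ≠ y → M.switchGraph.neighborSet v = {x, y} →
      M.IsLight v x y ∧ N v = ∅) (v x y : X ⊕ W) (hxy : x ≠ y)
    (hv : (T.addMarkers X M N).switchGraph.neighborSet v = {x, y}) :
    (T.addMarkers X M N).IsLight v x y := by
  have hx : (T.addMarkers X M N).Semiadj v x := by
    have : x ∈ (T.addMarkers X M N).switchGraph.neighborSet v := hv ▸ .inl rfl
    exact this
  have hy : (T.addMarkers X M N).Semiadj v y := by
    have : y ∈ (T.addMarkers X M N).switchGraph.neighborSet v := hv ▸ .inr rfl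
    exact this
  rcases v with v | v
  · rcases x with x | x
    swap
    · exact absurd hx addMarkers_not_semiadj_inl_inr
    rcases y with y | y
    swap
    · exact absurd hy addMarkers_not_semiadj_inl_inr
    -- No switchable pair leaves `X`, so `v` has the same switchable neighbours in `T` as in the
    -- block.
    have hnb : T.switchGraph.neighborSet (v : V) = {(x : V), (y : V)} := by
      ext z
      refine ⟨fun hz => ?_, ?_⟩
      · have hzX : z ∈ X := by
          by_contra hzX
          exact hs.no_switch v v.2 z hzX hz
        have hz' : (.inl ⟨z, hzX⟩ : X ⊕ W) ∈ (T.addMarkers X M N).switchGraph.neighborSet (.inl v) :=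
          addMarkers_semiadj_inl_inl.2 hz
        rw [hv] at hz'
        rcases hz' with h | h
        · exact .inl (congrArg Subtype.val (Sum.inl_injective h))
        · exact .inr (congrArg Subtype.val (Sum.inl_injective h))
      · rintro (rfl | rfl)
        · exact addMarkers_semiadj_inl_inl.1 hx
        · exact addMarkers_semiadj_inl_inl.1 hy
    have hne : (x : V) ≠ y := fun e => hxy (congrArg Sum.inl (Subtype.ext e))
    obtain ⟨a, ha⟩ := hs.nonempty₂.1
    obtain ⟨b, hb⟩ := hs.nonempty₂.2
    have haX : a ∈ Xᶜ := hs.eq₂ ▸ .inl (.inl ha)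
    have hbX : b ∈ Xᶜ := hs.eq₂ ▸ .inl (.inr hb)
    have hout : ∀ (z : V), z ∈ Xᶜ → ∀ u : X, z ≠ u := fun z hz u e => hz (e ▸ u.2)
    rcases hT v x y hne hnb with ⟨h, -⟩ | ⟨h, hxy'⟩
    -- A heavy `v` would be strongly adjacent to both `a ∈ A₂` and `b ∈ B₂`, hence lie in `A₁` and
    -- in `B₁`.
    · exfalso
      have h1 := hs.no_other v v.2 a haX (h a (hout a haX v) (hout a haX x) (hout a haX y))
      have h2 := hs.no_other v v.2 b hbX (h b (hout b hbX v) (hout b hbX x) (hout b hbX y))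
      have hd₁ : ¬ ((v : V) ∈ A₁ ∧ (v : V) ∈ B₁) := fun h =>
        Set.disjoint_left.1 hs.disj₁.1 h.1 h.2
      have hd₂ : ∀ z, ¬ (z ∈ A₂ ∧ z ∈ B₂) := fun z h => Set.disjoint_left.1 hs.disj₂.1 h.1 h.2
      have := hd₂ a
      have := hd₂ b
      tauto
    · refine ⟨?_, ?_⟩
      · rintro (z | w) hzv hzx hzy
        · have hzv' : (z : V) ≠ v := fun e => hzv (congrArg Sum.inl (Subtype.ext e))
          have hzx' : (z : V) ≠ x := fun e => hzx (congrArg Sum.inl (Subtype.ext e))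
          have hzy' : (z : V) ≠ y := fun e => hzy (congrArg Sum.inl (Subtype.ext e))
          exact ⟨hzv.symm, (h z hzv' hzx' hzy').2⟩
        · refine ⟨by simp, if_neg fun hvw => ?_⟩
          rcases hN w hvw with hvA | hvB
          · have h1 := (h a (hout a haX v) (hout a haX x) (hout a haX y)).2
            rw [(hs.complete_A v hvA a ha).2] at h1
            exact absurd h1 (by decide)
          · have h1 := (h b (hout b hbX v) (hout b hbX x) (hout b hbX y)).2
            rw [(hs.complete_B v hvB b hb).2] at h1
            exact absurd h1 (by decide)
      · exact ⟨hxy, hxy'.2⟩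
  · rcases x with x | x
    · exact absurd hx addMarkers_not_semiadj_inr_inl
    rcases y with y | y
    · exact absurd hy addMarkers_not_semiadj_inr_inl
    have hnb : M.switchGraph.neighborSet v = {x, y} := by
      ext z
      have := Set.ext_iff.1 hv (.inr z)
      simp only [Set.mem_insert_iff, Set.mem_singleton_iff, Sum.inr.injEq] at this ⊢
      rw [← this]
      exact addMarkers_semiadj_inr_inr.symm
    obtain ⟨⟨h, hxy'⟩, hNv⟩ := hM v x y (fun e => hxy (congrArg _ e)) hnb
    refine ⟨?_, hxy, hxy'.2⟩
    rintro (z | w) hzv hzx hzy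
    · exact ⟨by simp, if_neg (hNv ▸ Set.notMem_empty _)⟩
    · exact ⟨hzv.symm, (h w (fun e => hzv (congrArg _ e)) (fun e => hzx (congrArg _ e))
        (fun e => hzy (congrArg _ e))).2⟩

theorem oddMarkers_edgeSet_encard_le : oddMarkers.switchGraph.edgeSet.encard ≤ 2 := by
  have : oddMarkers.switchGraph.edgeSet ⊆ {s(.a, .b)} := by
    rintro ⟨_ | _, _ | _⟩ h
    · exact absurd rfl h.1
    · rfl
    · exact Sym2.eq_swap
    · exact absurd rfl h.1
  refine (Set.encard_le_encard this).trans ?_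
  rw [Set.encard_singleton]
  exact one_le_two

theorem oddMarkers_neighborSet_ne (v x y : OddMarker) (hxy : x ≠ y) :
    oddMarkers.switchGraph.neighborSet v ≠ {x, y} := by
  intro h
  have hx : x ∈ oddMarkers.switchGraph.neighborSet v := h ▸ .inl rfl
  have hy : y ∈ oddMarkers.switchGraph.neighborSet v := h ▸ .inr rfl
  have hx' := hx.1
  have hy' := hy.1
  rcases v with _ | _ <;> rcases x with _ | _ <;> rcases y with _ | _ <;> simp_all

theorem evenMarkers_edgeSet_encard_le :
    (evenMarkers (-1)).switchGraph.edgeSet.encard ≤ 2 := by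
  have : (evenMarkers (-1)).switchGraph.edgeSet ⊆ {s(.a, .c), s(.c, .b)} := by
    rintro ⟨_ | _ | _, _ | _ | _⟩ h
    · exact absurd rfl h.1
    · exact absurd h.2 (by decide)
    · exact .inl rfl
    · exact absurd h.2 (by decide)
    · exact absurd rfl h.1
    · exact .inr Sym2.eq_swap
    · exact .inl Sym2.eq_swap
    · exact .inr rfl
    · exact absurd rfl h.1
  refine (Set.encard_le_encard this).trans ((Set.encard_insert_le _ _).trans ?_)
  rw [Set.encard_singleton, one_add_one_eq_two]

theorem evenMarkers_isLight (v x y : EvenMarker) (hxy : x ≠ y)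
    (h : (evenMarkers (-1)).switchGraph.neighborSet v = {x, y}) :
    v = .c ∧ (evenMarkers (-1)).IsLight v x y := by
  have hx : x ∈ (evenMarkers (-1)).switchGraph.neighborSet v := h ▸ .inl rfl
  have hy : y ∈ (evenMarkers (-1)).switchGraph.neighborSet v := h ▸ .inr rfl
  have hab : (evenMarkers (-1)).θ .a .b ≠ 0 := by decide
  have hba : (evenMarkers (-1)).θ .b .a ≠ 0 := by decide
  have hvx := hx.1
  have hvy := hy.1
  have hx' := hx.2
  have hy' := hy.2
  clear hx hy h
  rcases v with _ | _ | _ <;> rcases x with _ | _ | _ <;> rcases y with _ | _ | _ <;>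
    first
    | exact absurd rfl hxy
    | exact absurd rfl hvx
    | exact absurd rfl hvy
    | exact absurd hx' hab
    | exact absurd hx' hba
    | exact absurd hy' hab
    | exact absurd hy' hba
    | refine ⟨rfl, ?_, hxy, rfl⟩
      rintro (_ | _ | _) h1 h2 h3
      all_goals first
        | exact absurd rfl h1
        | exact absurd rfl h2
        | exact absurd rfl h3

theorem IsProperSplit.oddBlock_inF (hT : T.InF) (hs : T.IsProperSplit X Xᶜ A₁ B₁ C₁ A₂ B₂ C₂)
    (hp : T.IsOddSplit A₁ B₁ C₁ A₂ B₂ C₂) : (T.oddBlock X A₁ B₁).InF where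
  berge := hs.oddBlock_isBerge hT.berge hp
  edges_le_two := addMarkers_edges_le_two hT.edges_le_two oddMarkers_edgeSet_encard_le
  heavy_or_light v x y hxy hv := .inr <| hs.1.addMarkers_heavy_or_light hT.heavy_or_light
    (by
      rintro (_ | _)
      · exact Set.subset_union_left
      · exact Set.subset_union_right)
    (fun v x y hxy h => absurd h (oddMarkers_neighborSet_ne v x y hxy)) v x y hxy hv

theorem IsProperSplit.evenBlock_inF (hT : T.InF) (hs : T.IsProperSplit X Xᶜ A₁ B₁ C₁ A₂ B₂ C₂)
    (hp : T.IsEvenSplit A₁ B₁ C₁ A₂ B₂ C₂) : (T.evenBlock X A₁ B₁).InF where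
  berge := hs.evenBlock_isBerge hT.berge hp
  edges_le_two := addMarkers_edges_le_two hT.edges_le_two evenMarkers_edgeSet_encard_le
  heavy_or_light v x y hxy hv := .inr <| hs.1.addMarkers_heavy_or_light hT.heavy_or_light
    (by
      rintro (_ | _ | _)
      · exact Set.subset_union_left
      · exact Set.subset_union_right
      · exact Set.empty_subset _)
    (fun v x y hxy h => by
      obtain ⟨rfl, hl⟩ := evenMarkers_isLight v x y hxy h
      exact ⟨hl, rfl⟩) v x y hxy hv

end Class

/-! ### Blocks of complement 2-joins -/

/-- Complementing swaps strong adjacency and strong antiadjacency at each marker, so its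
neighbourhood is complemented within `X`; values of `N` off `X` play no role. -/
theorem addMarkers_compl_eq {T : Trigraph V} {X : Set V} {M M' : Trigraph W} {N N' : W → Set V}
    (hM : M.compl = M') (hN : ∀ w, ∀ x ∈ X, x ∈ N' w ↔ x ∉ N w) :
    (T.compl.addMarkers X M N).compl = T.addMarkers X M' N' := by
  subst hM
  ext x y : 3
  rcases x with x | w <;> rcases y with y | w'
  · exact neg_neg _
  · have := hN w' x x.2
    by_cases h : (x : V) ∈ N w' <;> simp [compl, addMarkers, this, h]
  · have := hN w y y.2
    by_cases h : (y : V) ∈ N w <;> simp [compl, addMarkers, this, h]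
  · rfl

/-- This matches the neighbourhoods `B₁ ∪ C₁` and `A₁ ∪ C₁` of the complement blocks with the
complements in `X` of `A₁` and `B₁`. -/
theorem IsSplit.mem_union_iff {T : Trigraph V} {X X₂ A₁ B₁ C₁ A₂ B₂ C₂ : Set V}
    (hs : T.IsSplit X X₂ A₁ B₁ C₁ A₂ B₂ C₂) {x : V} (hx : x ∈ X) :
    (x ∈ B₁ ∪ C₁ ↔ x ∉ A₁) ∧ (x ∈ A₁ ∪ C₁ ↔ x ∉ B₁) := by
  have h1 := fun h : x ∈ A₁ => Set.disjoint_left.1 hs.disj₁.1 h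
  have h2 := fun h : x ∈ A₁ => Set.disjoint_left.1 hs.disj₁.2.1 h
  have h3 := fun h : x ∈ B₁ => Set.disjoint_left.1 hs.disj₁.2.2 h
  have h4 := hs.eq₁.subset hx
  simp only [Set.mem_union] at h4 ⊢
  tauto

theorem IsSplit.oddCoBlock_eq {T : Trigraph V} {X A₁ B₁ C₁ A₂ B₂ C₂ : Set V}
    (hs : T.compl.IsSplit X Xᶜ A₁ B₁ C₁ A₂ B₂ C₂) :
    T.oddCoBlock X A₁ B₁ C₁ = (T.compl.oddBlock X A₁ B₁).compl := by
  refine (addMarkers_compl_eq ?_ ?_).symm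
  · ext x y : 3
    exact neg_zero
  · rintro (_ | _) x hx
    · exact (hs.mem_union_iff hx).1
    · exact (hs.mem_union_iff hx).2

theorem IsSplit.evenCoBlock_eq {T : Trigraph V} {X A₁ B₁ C₁ A₂ B₂ C₂ : Set V}
    (hs : T.compl.IsSplit X Xᶜ A₁ B₁ C₁ A₂ B₂ C₂) :
    T.evenCoBlock X A₁ B₁ C₁ = (T.compl.evenBlock X A₁ B₁).compl := by
  refine (addMarkers_compl_eq ?_ ?_).symm
  · ext x y : 3
    rcases x with _ | _ | _ <;> rcases y with _ | _ | _ <;> rfl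
  · rintro (_ | _ | _) x hx
    · exact (hs.mem_union_iff hx).1
    · exact (hs.mem_union_iff hx).2
    · simpa using hx

/-! ### The main theorem -/

theorem IsProperSplit.isOddSplit_or_isEvenSplit {T : Trigraph V}
    {X₁ X₂ A₁ B₁ C₁ A₂ B₂ C₂ : Set V} (hs : T.IsProperSplit X₁ X₂ A₁ B₁ C₁ A₂ B₂ C₂) :
    T.IsOddSplit A₁ B₁ C₁ A₂ B₂ C₂ ∨ T.IsEvenSplit A₁ B₁ C₁ A₂ B₂ C₂ := by
  obtain ⟨n, p, hp⟩ := hs.2.1.exists_isLinkingPath hs.1.eq₁ hs.1.nonempty₁.1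
  rcases Nat.even_or_odd n with hn | hn
  · exact .inr ⟨n, hn, p, .inl hp⟩
  · exact .inl ⟨n, hn, p, .inl hp⟩

theorem IsFragment.exists_isBlock {T : Trigraph V} {X : Set V} (hX : T.IsFragment X) :
    ∃ (W : Type u) (T' : Trigraph W), T.IsBlock X T' := by
  rcases hX with ⟨A₁, B₁, C₁, A₂, B₂, C₂, hs⟩ | ⟨A₁, B₁, C₁, A₂, B₂, C₂, hs⟩ <;>
    rcases hs.isOddSplit_or_isEvenSplit with hp | hp
  · exact ⟨_, _, .odd _ _ _ _ _ _ hs hp⟩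
  · exact ⟨_, _, .even _ _ _ _ _ _ hs hp⟩
  · exact ⟨_, _, .oddCo _ _ _ _ _ _ hs hp⟩
  · exact ⟨_, _, .evenCo _ _ _ _ _ _ hs hp⟩

theorem IsBlock.inF {T : Trigraph V} (hT : T.InF) {X : Set V} {W : Type u} {T' : Trigraph W}
    (h : T.IsBlock X T') : T'.InF := by
  cases h with
  | odd A₁ B₁ C₁ A₂ B₂ C₂ hs hp => exact hs.oddBlock_inF hT hp
  | even A₁ B₁ C₁ A₂ B₂ C₂ hs hp => exact hs.evenBlock_inF hT hp
  | oddCo A₁ B₁ C₁ A₂ B₂ C₂ hs hp =>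
    rw [hs.1.oddCoBlock_eq]
    exact (hs.oddBlock_inF hT.compl hp).compl
  | evenCo A₁ B₁ C₁ A₂ B₂ C₂ hs hp =>
    rw [hs.1.evenCoBlock_eq]
    exact (hs.evenBlock_inF hT.compl hp).compl

theorem IsBlock.finite [Finite V] {T : Trigraph V} {X : Set V} {W : Type u} {T' : Trigraph W}
    (h : T.IsBlock X T') : Finite W := by
  have h1 : Finite OddMarker :=
    .of_surjective (fun t : Bool => if t then OddMarker.a else .b) fun
      | .a => ⟨true, rfl⟩
      | .b => ⟨false, rfl⟩
  have h2 : Finite EvenMarker :=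
    .of_surjective (![.a, .b, .c] : Fin 3 → EvenMarker) fun
      | .a => ⟨0, rfl⟩
      | .b => ⟨1, rfl⟩
      | .c => ⟨2, rfl⟩
  cases h <;> infer_instance

end Trigraph

theorem mainTheorem6 {V : Type u} [Finite V] (T : Trigraph V) (hF : T.InF)
    (hT : ¬ T.HasBalancedSkewPartition) (X : Set V) (hX : T.IsFragment X) :
    (∃ (W : Type u) (T' : Trigraph W), T.IsBlock X T') ∧
    ∀ (W : Type u) (T' : Trigraph W), T.IsBlock X T' → Finite W ∧ T'.InF ∧ T'.IsBerge :=
  ⟨hX.exists_isBlock, fun _ _ h => ⟨h.finite, h.inF hF, (h.inF hF).berge⟩⟩
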